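/- All systems are finite-dimensional and $\log$ is to base $2$. For a density operator $\rho_{AB}$ put $$H_{\min}(A|B)_\rho=-\inf_{\sigma_B}\inf\{\lambda\in\mathbb R:\ \rho_{AB}\le 2^{\lambda}\,\mathsf{id}_A\otimes\sigma_B\},$$ where $\sigma_B$ ranges over the density operators on $B$. A cq-state, classical on $A$, is a state $\sum_a p_a|a\rangle\langle a|_A\otimes\rho_B^a$ with $(p_a)$ a probability distribution and $\rho^a_B$ density operators. A CPTP map $\Gamma:L(\mathcal A\otimes\mathcal B)\to L(\mathcal A\otimes\mathcal B')$ is classically controlled by $A$ if there are CPTP maps $\Gamma^a$ such that $\Gamma\big(\sum_a p_a|a\rangle\langle a|\otimes\rho^a\big)=\sum_a p_a|a\rangle\langle a|\otimes\Gamma^a(\rho^a)$ for every cq-state. Let $m\ge 0$, let $\rho_{A_0'B_0'}$ be a cq-state with $A_0'$ classical, and let Alice and Bob share the initial state $$\rho=|\Phi^+\rangle\langle\Phi^+|^{\otimes m}_{A_0''B_0''}\otimes\rho_{A_0'B_0'},\qquad |\Phi^+\rangle=\tfrac1{\sqrt2}(|00\rangle+|11\rangle),$$ where Alice holds $A_0'A_0''$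 and Bob holds $B_0=B_0'B_0''$. They run a protocol with $r\ge1$ rounds, with memory spaces $\mathcal A_1,\dots,\mathcal A_r$ and $\mathcal B_1,\dots,\mathcal B_r$ and message spaces $\mathcal X_1,\dots,\mathcal X_r$ (Alice to Bob) and $\mathcal Y_1,\dots,\mathcal Y_{r-1}$ (Bob to Alice). In turn, Alice applies $$\Phi_1:L(\mathcal A_0'\otimes\mathcal A_0'')\to L(\mathcal A_0'\otimes\mathcal A_1\otimes\mathcal X_1),\qquad \Phi_i:L(\mathcal A_0'\otimes\mathcal A_{i-1}\otimes\mathcal Y_{i-1})\to L(\mathcal A_0'\otimes\mathcal A_i\otimes\mathcal X_i)\quad(2\le i\le r),$$ all classically controlled by $A_0'$, and Bob applies CPTP maps $$\Psi_j:L(\mathcal B_{j-1}\otimes\mathcal X_j)\to L(\mathcal B_j\otimes\mathcal Y_j)\quad(1\le j\le r-1),\qquad \Psi_r:L(\mathcal B_{r-1}\otimes\mathcal X_r)\to L(\mathcal B_r),$$ in the order $\Phi_1,\Psi_1,\dots,\Phi_r,\Psi_r$. Let $m_A=\sum_{i=1}^r\log\dim\mathcal X_i$ and $m_B=\sum_{j=1}^{r-1}\log\dim\mathcal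 Y_j$, let $m_A\le m$, and let $\sigma_{A_0'A_rB_r}$ be the final state. Then $$H_{\min}(A_0'|B_r)_\sigma\ \ge\ H_{\min}(A_0'|B_0)_\rho-2m_A ,$$ whatever the value of $m_B$. -/

import Mathlib

open scoped Kronecker ComplexOrder

noncomputable section

namespace LeakageChain

/-- Linear maps `L(ℂ^I) → L(ℂ^J)`; a finite-dimensional system is given by the finite index type of
its computational basis, and the tensor product of two systems by the product of the index types. -/
abbrev SuperOp (I J : Type) : Type := Matrix I I ℂ →ₗ[ℂ] Matrix J J ℂ

/-- Density operators: positive semidefinite of trace one. -/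
def IsDensity {I : Type} [Fintype I] (ρ : Matrix I I ℂ) : Prop :=
  ρ.PosSemidef ∧ ρ.trace = 1

/-- Completely positive trace-preserving maps: `T(M) = ∑ₖ Eₖ M Eₖ†` with `∑ₖ Eₖ† Eₖ = id`. -/
def IsCPTP {I J : Type} [Fintype I] [DecidableEq I] [Fintype J] (T : SuperOp I J) : Prop :=
  ∃ (n : ℕ) (E : Fin n → Matrix J I ℂ),
    (∑ k, (E k).conjTranspose * E k = 1) ∧
      ∀ M : Matrix I I ℂ, T M = ∑ k, E k * M * (E k).conjTranspose

/-- The operator `∑ₐ pₐ |a⟩⟨a| ⊗ ρᵃ`. -/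
def cqOperator {C B : Type} [Fintype C] [DecidableEq C] (p : C → ℝ) (ρ : C → Matrix B B ℂ) :
    Matrix (C × B) (C × B) ℂ :=
  ∑ a, (p a : ℂ) • (Matrix.single a a (1 : ℂ) ⊗ₖ ρ a)

/-- Probability distributions on a finite set. -/
def IsProbability {C : Type} [Fintype C] (p : C → ℝ) : Prop :=
  (∀ a, 0 ≤ p a) ∧ ∑ a, p a = 1

/-- Classical-quantum states, classical on `C`. -/
def IsCQState {C B : Type} [Fintype C] [DecidableEq C] [Fintype B]
    (ρ : Matrix (C × B) (C × B) ℂ) : Prop :=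
  ∃ (p : C → ℝ) (ρB : C → Matrix B B ℂ),
    IsProbability p ∧ (∀ a, IsDensity (ρB a)) ∧ ρ = cqOperator p ρB

/-- A quantum operation on `C ⊗ B` is controlled by the classical system `C` if it sends every
cq-state `∑ₐ pₐ |a⟩⟨a| ⊗ ρᵃ` to `∑ₐ pₐ |a⟩⟨a| ⊗ Γᵃ(ρᵃ)`, for fixed CPTP maps `Γᵃ`. -/
def IsClassicallyControlled {C B B' : Type} [Fintype C] [DecidableEq C] [Fintype B] [DecidableEq B]
    [Fintype B'] (T : SuperOp (C × B) (C × B')) : Prop :=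
  IsCPTP T ∧ ∃ Γ : C → SuperOp B B', (∀ a, IsCPTP (Γ a)) ∧
    ∀ (p : C → ℝ) (ρ : C → Matrix B B ℂ), IsProbability p → (∀ a, IsDensity (ρ a)) →
      T (cqOperator p ρ) = cqOperator p (fun a => Γ a (ρ a))

/-- The action of `T ⊗ id_R`: `T` is applied to every block of the operator. -/
def tensorId {I J : Type} (R : Type) (T : SuperOp I J) (M : Matrix (I × R) (I × R) ℂ) :
    Matrix (J × R) (J × R) ℂ :=
  Matrix.of fun x y => T (Matrix.of fun i i' => M (i, x.2) (i', y.2)) x.1 y.1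

/-- The action of an operation of Alice (classical register `C`, workspace `A`) on a joint operator
on `C ⊗ A ⊗ B`, with the identity on Bob's system `B`; it outputs a memory `A'` and a message `X`,
the message being put on Bob's side. -/
def aliceStep {C A B A' X : Type} (T : SuperOp (C × A) (C × (A' × X)))
    (M : Matrix (C × A × B) (C × A × B) ℂ) :
    Matrix (C × A' × (B × X)) (C × A' × (B × X)) ℂ :=
  (tensorId B T (M.submatrix (fun x : (C × A) × B => (x.1.1, x.1.2, x.2))
      (fun x : (C × A) × B => (x.1.1, x.1.2, x.2)))).submatrix
    (fun x => ((x.1, (x.2.1, x.2.2.2)), x.2.2.1)) (fun x => ((x.1, (x.2.1, x.2.2.2)), x.2.2.1))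

/-- The action of an operation of Bob on a joint operator on `C ⊗ A ⊗ B`, with the identity on
Alice's systems `C ⊗ A`. -/
def bobStep {C A B B' : Type} (T : SuperOp B B')
    (M : Matrix (C × A × B) (C × A × B) ℂ) : Matrix (C × A × B') (C × A × B') ℂ :=
  (tensorId (C × A) T (M.submatrix (fun x : B × (C × A) => (x.2.1, x.2.2, x.1))
      (fun x : B × (C × A) => (x.2.1, x.2.2, x.1)))).submatrix
    (fun x => (x.2.2, (x.1, x.2.1))) (fun x => (x.2.2, (x.1, x.2.1)))

/-- Bob's message `Y` is handed over to Alice. -/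
def handOver {C A B Y : Type} (M : Matrix (C × A × (B × Y)) (C × A × (B × Y)) ℂ) :
    Matrix (C × (A × Y) × B) (C × (A × Y) × B) ℂ :=
  M.submatrix (fun x => (x.1, x.2.1.1, (x.2.2, x.2.1.2)))
    (fun x => (x.1, x.2.1.1, (x.2.2, x.2.1.2)))

/-- The quantum system on which Alice acts in round `i + 1`: her initial quantum system `A₀` for
`i = 0`, her memory `A_i` together with Bob's message `Y_i` for `i ≥ 1`. -/
def AliceIn (A₀ : Type) (dA dY : ℕ → ℕ) : ℕ → Type
  | 0 => A₀
  | i + 1 => Fin (dA (i + 1)) × Fin (dY (i + 1))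

instance AliceIn.instFintype (A₀ : Type) [Fintype A₀] (dA dY : ℕ → ℕ) :
    (i : ℕ) → Fintype (AliceIn A₀ dA dY i)
  | 0 => inferInstanceAs (Fintype A₀)
  | i + 1 => inferInstanceAs (Fintype (Fin (dA (i + 1)) × Fin (dY (i + 1))))

instance AliceIn.instDecidableEq (A₀ : Type) [DecidableEq A₀] (dA dY : ℕ → ℕ) :
    (i : ℕ) → DecidableEq (AliceIn A₀ dA dY i)
  | 0 => inferInstanceAs (DecidableEq A₀)
  | i + 1 => inferInstanceAs (DecidableEq (Fin (dA (i + 1)) × Fin (dY (i + 1))))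

/-- Bob's memory `B_j`: his input system `B₀` for `j = 0`, of dimension `dB j` for `j ≥ 1`. -/
def BobMem (B₀ : Type) (dB : ℕ → ℕ) : ℕ → Type
  | 0 => B₀
  | j + 1 => Fin (dB (j + 1))

instance BobMem.instFintype (B₀ : Type) [Fintype B₀] (dB : ℕ → ℕ) :
    (j : ℕ) → Fintype (BobMem B₀ dB j)
  | 0 => inferInstanceAs (Fintype B₀)
  | j + 1 => inferInstanceAs (Fintype (Fin (dB (j + 1))))

instance BobMem.instDecidableEq (B₀ : Type) [DecidableEq B₀] (dB : ℕ → ℕ) :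
    (j : ℕ) → DecidableEq (BobMem B₀ dB j)
  | 0 => inferInstanceAs (DecidableEq B₀)
  | j + 1 => inferInstanceAs (DecidableEq (Fin (dB (j + 1))))

/-- Two-party protocols with `r = n + 1` rounds (so `r ≥ 1`; Alice sends the first and the last
message) in which Alice's operations are controlled by her classical register `C`, which is
preserved. Initially Alice holds `C` and a quantum system `A₀`, and Bob holds `B₀`. The memory spaces
`A_i`, `B_i` and the message spaces `X_i` (Alice to Bob), `Y_i` (Bob to Alice) have the dimensions
`dA i`, `dB i`, `dX i`, `dY i` for `i ≥ 1`. `Φ i` is Alice's operation in round `i + 1` and `Ψ j`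
Bob's operation in round `j + 1 < r`; in the last round Bob applies `Ψlast` and sends nothing.
Entries for other indices play no role. -/
structure Protocol (C A₀ B₀ : Type) [Fintype C] [DecidableEq C] [Fintype A₀] [DecidableEq A₀]
    [Fintype B₀] [DecidableEq B₀] (n : ℕ) where
  dA : ℕ → ℕ
  dB : ℕ → ℕ
  dX : ℕ → ℕ
  dY : ℕ → ℕ
  Φ : (i : ℕ) → SuperOp (C × AliceIn A₀ dA dY i) (C × (Fin (dA (i + 1)) × Fin (dX (i + 1))))
  Ψ : (j : ℕ) → SuperOp (BobMem B₀ dB j × Fin (dX (j + 1)))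
    (Fin (dB (j + 1)) × Fin (dY (j + 1)))
  Ψlast : SuperOp (BobMem B₀ dB n × Fin (dX (n + 1))) (Fin (dB (n + 1)))
  controlled : ∀ i ≤ n, IsClassicallyControlled (Φ i)
  cptp : ∀ j < n, IsCPTP (Ψ j)
  cptp_last : IsCPTP Ψlast

namespace Protocol

/-- The joint operator after the first `k` rounds and the delivery of Bob's message `Y_k`. -/
def stateAfter {C A₀ B₀ : Type} [Fintype C] [DecidableEq C] [Fintype A₀] [DecidableEq A₀]
    [Fintype B₀] [DecidableEq B₀] {n : ℕ} (P : Protocol C A₀ B₀ n)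
    (M : Matrix (C × A₀ × B₀) (C × A₀ × B₀) ℂ) :
    (k : ℕ) → Matrix (C × AliceIn A₀ P.dA P.dY k × BobMem B₀ P.dB k)
      (C × AliceIn A₀ P.dA P.dY k × BobMem B₀ P.dB k) ℂ
  | 0 => M
  | k + 1 => handOver (bobStep (P.Ψ k) (aliceStep (P.Φ k) (P.stateAfter M k)))

/-- The joint operator on `C ⊗ A_r ⊗ B_r` at the end of the protocol, where `r = n + 1`. -/
def run {C A₀ B₀ : Type} [Fintype C] [DecidableEq C] [Fintype A₀] [DecidableEq A₀]
    [Fintype B₀] [DecidableEq B₀] {n : ℕ} (P : Protocol C A₀ B₀ n)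
    (M : Matrix (C × A₀ × B₀) (C × A₀ × B₀) ℂ) :
    Matrix (C × Fin (P.dA (n + 1)) × Fin (P.dB (n + 1)))
      (C × Fin (P.dA (n + 1)) × Fin (P.dB (n + 1))) ℂ :=
  bobStep P.Ψlast (aliceStep (P.Φ n) (P.stateAfter M n))

/-- The number `∑_{i=1}^r log₂ dim X_i` of qubits sent from Alice to Bob. -/
def commA {C A₀ B₀ : Type} [Fintype C] [DecidableEq C] [Fintype A₀] [DecidableEq A₀]
    [Fintype B₀] [DecidableEq B₀] {n : ℕ} (P : Protocol C A₀ B₀ n) : ℝ :=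
  ∑ i ∈ Finset.range (n + 1), Real.logb 2 (P.dX (i + 1))

/-- The number `∑_{j=1}^{r-1} log₂ dim Y_j` of qubits sent from Bob to Alice. -/
def commB {C A₀ B₀ : Type} [Fintype C] [DecidableEq C] [Fintype A₀] [DecidableEq A₀]
    [Fintype B₀] [DecidableEq B₀] {n : ℕ} (P : Protocol C A₀ B₀ n) : ℝ :=
  ∑ j ∈ Finset.range n, Real.logb 2 (P.dY (j + 1))

end Protocol

/-- Partial trace over Alice's quantum system: `C ⊗ A ⊗ B` to `C ⊗ B`. -/
def traceAlice {C A B : Type} [Fintype A] (M : Matrix (C × A × B) (C × A × B) ℂ) :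
    Matrix (C × B) (C × B) ℂ :=
  Matrix.of fun x y => ∑ a, M (x.1, a, x.2) (y.1, a, y.2)

/-- The conditional min-entropy `H_min(A|B)_ρ`: minus the infimum of all real `l` such that
`ρ ≤ 2^l • (id_A ⊗ σ)` for some density operator `σ` on `B`. For a density operator `ρ` this set
is nonempty and bounded below, so the infimum is the one over `σ` of the infima over `l`. -/
def minEntropy {A B : Type} [Fintype A] [DecidableEq A] [Fintype B]
    (ρ : Matrix (A × B) (A × B) ℂ) : ℝ :=
  -sInf {l : ℝ | ∃ σ : Matrix B B ℂ, IsDensity σ ∧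
    ((((2 : ℝ) ^ l : ℝ) : ℂ) • ((1 : Matrix A A ℂ) ⊗ₖ σ) - ρ).PosSemidef}

/-- The computational basis of `m` qubits. -/
abbrev Qubits (m : ℕ) : Type := Fin m → Fin 2

/-- The vector `(|00⟩ + |11⟩) / √2`. -/
def eprVector : Fin 2 × Fin 2 → ℂ :=
  fun x => if x.1 = x.2 then ((Real.sqrt 2 : ℝ) : ℂ)⁻¹ else 0

/-- The density operator of `m` EPR pairs; the `k`-th pair consists of the `k`-th qubit of either
side. -/
def eprPairs (m : ℕ) : Matrix (Qubits m × Qubits m) (Qubits m × Qubits m) ℂ :=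
  Matrix.vecMulVec (fun x => ∏ k, eprVector (x.1 k, x.2 k))
    (star fun x => ∏ k, eprVector (x.1 k, x.2 k))

/-- The initial state: `m` EPR pairs tensored with `ρ`. Alice holds `C` and one half of each pair,
Bob holds `B` and the other halves. -/
def initialState {C B : Type} (m : ℕ) (ρ : Matrix (C × B) (C × B) ℂ) :
    Matrix (C × Qubits m × (B × Qubits m)) (C × Qubits m × (B × Qubits m)) ℂ :=
  (eprPairs m ⊗ₖ ρ).submatrix (fun x => ((x.2.1, x.2.2.2), (x.1, x.2.2.1)))
    (fun x => ((x.2.1, x.2.2.2), (x.1, x.2.2.1)))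

end LeakageChain

end

/-! Only the reduced state of the classical register `C` and Bob's system matters. Bob's
operations and the handing over of his messages are quantum operations on Bob's side, and these
do not decrease the min-entropy: apply them to both sides of `ρ ≤ 2 ^ l • (id ⊗ σ)`. An
operation of Alice controlled by `C` does not change the reduced state once her message `X` is
discarded, since it acts on the blocks of a state that is classical on `C` and preserves their
traces. Receiving `X` then costs at most `2 log dim X`: every positive `M` on `B ⊗ X` satisfies
`M ≤ dim X • (tr_X M ⊗ id_X)`, and a second factor `dim X` normalizes `id_X` to a density
operator. -/

namespace LeakageChain

open scoped MatrixOrder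

section LoewnerOrder

open Matrix

variable {𝕜 ι I J : Type*} [RCLike 𝕜]

lemma kronecker_le_kronecker_right {M N : Matrix I I 𝕜} {K : Matrix J J 𝕜} [Finite I] [Finite J]
    (hMN : M ≤ N) (hK : K.PosSemidef) : M ⊗ₖ K ≤ N ⊗ₖ K := by
  have hsub : N ⊗ₖ K - M ⊗ₖ K = (N - M) ⊗ₖ K := by
    rw [sub_eq_iff_eq_add, ← add_kronecker, sub_add_cancel]
  rw [le_iff, hsub]
  exact (le_iff.mp hMN).kronecker hK

lemma sum_mul_mul_conjTranspose_sum_le [Fintype I] [Finite J] {M : Matrix I I 𝕜}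
    (hM : M.PosSemidef) (s : Finset ι) (E : ι → Matrix J I 𝕜) :
    (∑ i ∈ s, E i) * M * (∑ i ∈ s, E i)ᴴ ≤ (s.card : 𝕜) • ∑ i ∈ s, E i * M * (E i)ᴴ := by
  set D := (s.card : 𝕜) • ∑ i ∈ s, E i * M * (E i)ᴴ - (∑ i ∈ s, E i) * M * (∑ i ∈ s, E i)ᴴ with hD
  have hsquares : ∑ i ∈ s, ∑ j ∈ s, (E i - E j) * M * (E i - E j)ᴴ = (2 : 𝕜) • D := by
    have hcross : (∑ i ∈ s, E i) * M * (∑ i ∈ s, E i)ᴴ =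
        ∑ i ∈ s, ∑ j ∈ s, E i * M * (E j)ᴴ := by
      simp only [conjTranspose_sum, Matrix.sum_mul, Matrix.mul_sum]
      exact Finset.sum_comm
    have hswap : ∑ i ∈ s, ∑ j ∈ s, E j * M * (E i)ᴴ = ∑ i ∈ s, ∑ j ∈ s, E i * M * (E j)ᴴ :=
      Finset.sum_comm
    simp only [hD, hcross, conjTranspose_sub, Matrix.sub_mul, Matrix.mul_sub,
      Finset.sum_sub_distrib, hswap, Finset.sum_const, ← Finset.smul_sum,
      ← Nat.cast_smul_eq_nsmul 𝕜]
    module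
  have hDpos : D = (2⁻¹ : 𝕜) • ∑ i ∈ s, ∑ j ∈ s, (E i - E j) * M * (E i - E j)ᴴ := by
    rw [hsquares, inv_smul_smul₀ two_ne_zero]
  rw [le_iff, ← hD, hDpos]
  exact (posSemidef_sum _ fun i _ => posSemidef_sum _ fun j _ =>
    hM.mul_mul_conjTranspose_same _).smul (by positivity)

lemma submatrix_equiv_le_iff {M N : Matrix I I 𝕜} (e : J ≃ I) :
    M.submatrix e e ≤ N.submatrix e e ↔ M ≤ N :=
  posSemidef_submatrix_equiv (M := N - M) e

lemma kronecker_finsetSum (K : Matrix I I 𝕜) (s : Finset ι) (N : ι → Matrix J J 𝕜) :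
    K ⊗ₖ ∑ i ∈ s, N i = ∑ i ∈ s, K ⊗ₖ N i :=
  map_sum (kroneckerBilinear (R := 𝕜) K) N s

lemma posSemidef_single_one [DecidableEq I] (i : I) :
    (single i i (1 : 𝕜)).PosSemidef :=
  diagonal_single i (1 : 𝕜) ▸ PosSemidef.diagonal (Pi.single_nonneg.mpr zero_le_one)

end LoewnerOrder

section Density

variable {I J : Type} [Fintype I] [Fintype J]

lemma IsDensity.nonempty {ρ : Matrix I I ℂ} (hρ : IsDensity ρ) : Nonempty I := by
  by_contra hI
  rw [not_nonempty_iff] at hI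
  simpa [Matrix.trace] using hρ.2

lemma IsDensity.kronecker {ρ : Matrix I I ℂ} {σ : Matrix J J ℂ} (hρ : IsDensity ρ)
    (hσ : IsDensity σ) : IsDensity (ρ ⊗ₖ σ) :=
  ⟨hρ.1.kronecker hσ.1, by rw [Matrix.trace_kronecker, hρ.2, hσ.2, one_mul]⟩

lemma IsDensity.submatrix_equiv {ρ : Matrix I I ℂ} (hρ : IsDensity ρ) (e : J ≃ I) :
    IsDensity (ρ.submatrix e e) :=
  ⟨hρ.1.submatrix e, (e.sum_comp fun i => ρ i i).trans hρ.2⟩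

lemma isDensity_vecMulVec_star {v : I → ℂ} (hv : v ⬝ᵥ star v = 1) :
    IsDensity (Matrix.vecMulVec v (star v)) :=
  ⟨Matrix.posSemidef_vecMulVec_self_star v, by rw [Matrix.trace_vecMulVec, hv]⟩

variable (I) in
lemma isDensity_maximallyMixed [DecidableEq I] [Nonempty I] :
    IsDensity ((Fintype.card I : ℂ)⁻¹ • (1 : Matrix I I ℂ)) := by
  refine ⟨Matrix.PosSemidef.one.smul (inv_nonneg.mpr (Nat.cast_nonneg _)), ?_⟩
  rw [Matrix.trace_smul, Matrix.trace_one, smul_eq_mul, inv_mul_cancel₀ (by simp)]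

lemma exists_isDensity_trace_smul_eq [Nonempty I] {M : Matrix I I ℂ} (hM : M.PosSemidef) :
    ∃ ρ, IsDensity ρ ∧ M.trace • ρ = M := by
  classical
  by_cases htr : M.trace = 0
  · refine ⟨_, isDensity_maximallyMixed I, ?_⟩
    rw [hM.trace_eq_zero_iff.mp htr, Matrix.trace_zero, zero_smul]
  · refine ⟨M.trace⁻¹ • M, ⟨hM.smul (inv_nonneg.mpr hM.trace_nonneg), ?_⟩,
      smul_inv_smul₀ htr M⟩
    rw [Matrix.trace_smul, smul_eq_mul, inv_mul_cancel₀ htr]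

open scoped Matrix.Norms.L2Operator in
lemma linearMap_ext_isDensity {E : Type*} [AddCommGroup E] [Module ℂ E]
    {S T : Matrix I I ℂ →ₗ[ℂ] E} (h : ∀ ρ, IsDensity ρ → S ρ = T ρ) : S = T := by
  classical
  cases isEmpty_or_nonempty I
  · exact LinearMap.ext fun M => by rw [Subsingleton.elim M 0, map_zero, map_zero]
  · refine LinearMap.ext_on CStarAlgebra.span_nonneg fun M hM => ?_
    obtain ⟨ρ, hρ, hρM⟩ := exists_isDensity_trace_smul_eq (Matrix.nonneg_iff_posSemidef.mp hM)
    rw [← hρM, map_smul, map_smul, h ρ hρ]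

end Density

section Operations

open Matrix

variable {I J R B X : Type}

/-- The operation `id_R ⊗ T`. The order of the factors is opposite to that of `tensorId`, as the
min-entropy is conditioned on the right factor. -/
def idTensor (R : Type) (T : SuperOp I J) : SuperOp (R × I) (R × J) where
  toFun M := of fun x y => T (of fun i i' => M (x.1, i) (y.1, i')) x.2 y.2
  map_add' M N := by
    ext x y
    exact congrFun₂ (map_add T (of fun i i' => M (x.1, i) (y.1, i'))
      (of fun i i' => N (x.1, i) (y.1, i'))) x.2 y.2
  map_smul' c M := by
    ext x y
    exact congrFun₂ (map_smul T c (of fun i i' => M (x.1, i) (y.1, i'))) x.2 y.2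

lemma idTensor_kronecker (T : SuperOp I J) (K : Matrix R R ℂ) (σ : Matrix I I ℂ) :
    idTensor R T (K ⊗ₖ σ) = K ⊗ₖ T σ := by
  ext x y
  exact congrFun₂ (map_smul T (K x.1 y.1) σ) x.2 y.2

/-- The partial trace over the right factor. -/
def traceRight (B X : Type) [Fintype X] : SuperOp (B × X) B where
  toFun M := ∑ x, M.submatrix (·, x) (·, x)
  map_add' M N := by simp only [submatrix_add, Pi.add_apply, Finset.sum_add_distrib]
  map_smul' c M := by
    simp only [submatrix_smul, Pi.smul_apply, Finset.smul_sum, RingHom.id_apply]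

variable [Fintype X]

lemma traceRight_apply (M : Matrix (B × X) (B × X) ℂ) (b b' : B) :
    traceRight B X M b b' = ∑ x, M (b, x) (b', x) :=
  Matrix.sum_apply _ _ _ _

lemma traceRight_kronecker (K : Matrix B B ℂ) (N : Matrix X X ℂ) :
    traceRight B X (K ⊗ₖ N) = N.trace • K := by
  ext b b'
  rw [traceRight_apply, Matrix.smul_apply, smul_eq_mul, mul_comm]
  exact (Finset.mul_sum Finset.univ (fun x => N x x) (K b b')).symm

lemma submatrix_le_traceRight [Finite B] {M : Matrix (B × X) (B × X) ℂ} (hM : M.PosSemidef)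
    (x : X) : M.submatrix (·, x) (·, x) ≤ traceRight B X M :=
  Finset.single_le_sum (f := fun x => M.submatrix (·, x) (·, x))
    (fun _ _ => (hM.submatrix _).nonneg) (Finset.mem_univ x)

lemma one_kronecker_single_mul_mul [Fintype B] [DecidableEq B] [DecidableEq X]
    (M : Matrix (B × X) (B × X) ℂ) (x : X) :
    ((1 : Matrix B B ℂ) ⊗ₖ single x x (1 : ℂ)) * M * ((1 : Matrix B B ℂ) ⊗ₖ single x x (1 : ℂ))ᴴ =
      M.submatrix (·, x) (·, x) ⊗ₖ single x x (1 : ℂ) := by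
  ext ⟨b, y⟩ ⟨b', y'⟩
  simp [Matrix.mul_apply, Fintype.sum_prod_type, one_apply, single_apply, ite_and,
    apply_ite (starRingEnd ℂ)]
  split_ifs <;> rfl

-- Pinching by the projections onto the basis vectors of `X` costs at most their number, by the
-- operator Cauchy–Schwarz inequality.
lemma le_card_smul_traceRight_kronecker_one [Finite B] [DecidableEq X]
    {M : Matrix (B × X) (B × X) ℂ} (hM : M.PosSemidef) :
    M ≤ (Fintype.card X : ℂ) • (traceRight B X M ⊗ₖ (1 : Matrix X X ℂ)) := by
  classical
  cases nonempty_fintype B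
  let F (x : X) : Matrix (B × X) (B × X) ℂ := 1 ⊗ₖ single x x 1
  have hF : ∑ x, F x = 1 := by
    rw [← kronecker_finsetSum, sum_single_one, one_kronecker_one]
  calc M = (∑ x, F x) * M * (∑ x, F x)ᴴ := by simp [hF]
    _ ≤ (Fintype.card X : ℂ) • ∑ x, F x * M * (F x)ᴴ :=
      sum_mul_mul_conjTranspose_sum_le hM Finset.univ F
    _ = (Fintype.card X : ℂ) • ∑ x, M.submatrix (·, x) (·, x) ⊗ₖ single x x (1 : ℂ) := by
      simp only [F, one_kronecker_single_mul_mul]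
    _ ≤ (Fintype.card X : ℂ) • ∑ x, traceRight B X M ⊗ₖ single x x (1 : ℂ) :=
      smul_le_smul_of_nonneg_left (Finset.sum_le_sum fun x _ =>
        kronecker_le_kronecker_right (submatrix_le_traceRight hM x) (posSemidef_single_one x))
        (Nat.cast_nonneg _)
    _ = (Fintype.card X : ℂ) • (traceRight B X M ⊗ₖ (1 : Matrix X X ℂ)) := by
      rw [← kronecker_finsetSum, sum_single_one]

variable [Fintype I] [DecidableEq I] [Fintype J]

lemma isCPTP_of_kraus {ι : Type*} [Fintype ι] {T : SuperOp I J} (E : ι → Matrix J I ℂ)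
    (hE : ∑ k, (E k)ᴴ * E k = 1) (hT : ∀ M, T M = ∑ k, E k * M * (E k)ᴴ) : IsCPTP T := by
  let e := (Fintype.equivFin ι).symm
  refine ⟨Fintype.card ι, E ∘ e, ?_, fun M => ?_⟩
  · rw [← hE]
    exact e.sum_comp fun k => (E k)ᴴ * E k
  · rw [hT]
    exact (e.sum_comp fun k => E k * M * (E k)ᴴ).symm

namespace IsCPTP

variable {T : SuperOp I J}

lemma trace_apply (hT : IsCPTP T) (M : Matrix I I ℂ) : (T M).trace = M.trace := by
  obtain ⟨n, E, hE, hTE⟩ := hT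
  calc (T M).trace = ∑ k, ((E k)ᴴ * E k * M).trace := by
        rw [hTE, trace_sum]
        exact Finset.sum_congr rfl fun k _ => by rw [trace_mul_comm, Matrix.mul_assoc]
    _ = M.trace := by rw [← trace_sum, ← Finset.sum_mul, hE, Matrix.one_mul]

lemma posSemidef_apply (hT : IsCPTP T) {M : Matrix I I ℂ} (hM : M.PosSemidef) :
    (T M).PosSemidef := by
  obtain ⟨n, E, -, hTE⟩ := hT
  rw [hTE]
  exact posSemidef_sum _ fun k _ => hM.mul_mul_conjTranspose_same _

lemma monotone (hT : IsCPTP T) : Monotone T := fun M N hMN => by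
  rw [le_iff, ← map_sub]
  exact hT.posSemidef_apply hMN

lemma isDensity_apply (hT : IsCPTP T) {ρ : Matrix I I ℂ} (hρ : IsDensity ρ) : IsDensity (T ρ) :=
  ⟨hT.posSemidef_apply hρ.1, by rw [hT.trace_apply, hρ.2]⟩

end IsCPTP

lemma IsCPTP.idTensor [Fintype R] [DecidableEq R] {T : SuperOp I J} (hT : IsCPTP T) :
    IsCPTP (idTensor R T) := by
  obtain ⟨n, E, hE, hTE⟩ := hT
  refine ⟨n, fun k => (1 : Matrix R R ℂ) ⊗ₖ E k, ?_, fun M => ?_⟩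
  · simp only [conjTranspose_kronecker, ← mul_kronecker_mul, conjTranspose_one, Matrix.one_mul]
    rw [← one_kronecker_one, ← hE]
    exact (kronecker_finsetSum 1 Finset.univ fun k => (E k)ᴴ * E k).symm
  · ext ⟨r, j⟩ ⟨r', j'⟩
    simp [LeakageChain.idTensor, hTE, Matrix.sum_apply, Matrix.mul_apply, Fintype.sum_prod_type,
      one_apply, apply_ite star]

lemma isCPTP_traceRight [Fintype B] [DecidableEq B] [DecidableEq X] : IsCPTP (traceRight B X) := by
  refine isCPTP_of_kraus (fun x => (1 : Matrix (B × X) (B × X) ℂ).submatrix (·, x) id) ?_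
    fun M => Finset.sum_congr rfl fun x _ => ?_
  · ext i j
    simp [Matrix.sum_apply, Matrix.mul_apply, one_apply, ← Fintype.sum_prod_type_right', eq_comm]
  · ext b b'
    simp [Matrix.mul_apply, one_apply]

end Operations

section ClassicalRegister

open Matrix

variable {C K L : Type}

/-- An operator on `C ⊗ K` is classical on `C` if it is block diagonal with respect to the
computational basis of `C`; a density operator with this property is a cq-state. -/
def IsClassical (M : Matrix (C × K) (C × K) ℂ) : Prop :=
  ∀ x y, x.1 ≠ y.1 → M x y = 0

variable [Fintype C] [DecidableEq C]

lemma isClassical_sum_single_kronecker (N : C → Matrix K K ℂ) :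
    IsClassical (∑ a, single a a (1 : ℂ) ⊗ₖ N a) := fun x y hxy => by
  rw [Matrix.sum_apply]
  refine Finset.sum_eq_zero fun a _ => ?_
  rw [kronecker_apply, single_apply_of_ne, zero_mul]
  exact fun h => hxy (h.1.symm.trans h.2)

lemma IsClassical.eq_sum_single_kronecker {M : Matrix (C × K) (C × K) ℂ} (hM : IsClassical M) :
    M = ∑ a, single a a (1 : ℂ) ⊗ₖ M.submatrix (a, ·) (a, ·) := by
  ext ⟨a, k⟩ ⟨b, l⟩
  rcases eq_or_ne a b with rfl | hab
  · simp [Matrix.sum_apply, single_apply]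
  · rw [hM _ _ hab, isClassical_sum_single_kronecker _ _ _ hab]

lemma cqOperator_eq_sum_single_kronecker (p : C → ℝ) (ρ : C → Matrix K K ℂ) :
    cqOperator p ρ = ∑ a, single a a (1 : ℂ) ⊗ₖ ((p a : ℂ) • ρ a) := by
  simp only [cqOperator, kronecker_smul]

lemma cqOperator_single (a : C) (ρ : C → Matrix K K ℂ) :
    cqOperator (Pi.single a 1) ρ = single a a (1 : ℂ) ⊗ₖ ρ a := by
  rw [cqOperator, Finset.sum_eq_single a (fun b _ hb => by simp [hb]) (by simp)]
  simp

variable [Fintype K]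

lemma IsCQState.isClassical {M : Matrix (C × K) (C × K) ℂ} (hM : IsCQState M) : IsClassical M := by
  obtain ⟨p, ρ, -, -, rfl⟩ := hM
  rw [cqOperator_eq_sum_single_kronecker]
  exact isClassical_sum_single_kronecker _

lemma IsCQState.isDensity {M : Matrix (C × K) (C × K) ℂ} (hM : IsCQState M) : IsDensity M := by
  obtain ⟨p, ρ, ⟨hp₀, hp₁⟩, hρ, rfl⟩ := hM
  constructor
  · exact posSemidef_sum _ fun a _ => ((posSemidef_single_one a).kronecker (hρ a).1).smul
      (Complex.zero_le_real.mpr (hp₀ a))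
  · simp only [cqOperator, trace_sum, trace_smul, trace_kronecker, trace_single_eq_same, (hρ _).2,
      mul_one, smul_eq_mul]
    exact_mod_cast hp₁

namespace IsClassicallyControlled

variable [DecidableEq K] [Fintype L] {T : SuperOp (C × K) (C × L)}

lemma exists_apply_single_kronecker (hT : IsClassicallyControlled T) :
    ∃ Γ : C → SuperOp K L, (∀ a, IsCPTP (Γ a)) ∧
      ∀ a N, T (single a a (1 : ℂ) ⊗ₖ N) = single a a (1 : ℂ) ⊗ₖ Γ a N := by
  obtain ⟨-, Γ, hΓ, hTΓ⟩ := hT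
  refine ⟨Γ, hΓ, fun a => LinearMap.congr_fun (f := T ∘ₗ kroneckerBilinear (single a a 1))
    (g := kroneckerBilinear (single a a 1) ∘ₗ Γ a) (linearMap_ext_isDensity fun ρ hρ => ?_)⟩
  have hdirac : IsProbability (Pi.single a 1 : C → ℝ) :=
    ⟨fun b => by by_cases hb : b = a <;> simp [hb], by simp⟩
  have hTρ := hTΓ (Pi.single a 1) (fun _ => ρ) hdirac fun _ => hρ
  rwa [cqOperator_single, cqOperator_single] at hTρ

lemma isClassical_apply (hT : IsClassicallyControlled T) {M : Matrix (C × K) (C × K) ℂ}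
    (hM : IsClassical M) : IsClassical (T M) := by
  obtain ⟨Γ, -, hTΓ⟩ := hT.exists_apply_single_kronecker
  rw [hM.eq_sum_single_kronecker, map_sum]
  simp only [hTΓ]
  exact isClassical_sum_single_kronecker _

lemma traceRight_apply (hT : IsClassicallyControlled T) {M : Matrix (C × K) (C × K) ℂ}
    (hM : IsClassical M) : traceRight C L (T M) = traceRight C K M := by
  obtain ⟨Γ, hΓ, hTΓ⟩ := hT.exists_apply_single_kronecker
  rw [hM.eq_sum_single_kronecker]
  simp only [map_sum, hTΓ, traceRight_kronecker, (hΓ _).trace_apply]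

end IsClassicallyControlled

end ClassicalRegister

section MinEntropy

open Matrix

variable {A A' B B' X : Type} [Fintype A] [DecidableEq A] [Fintype B]
  [Fintype A'] [DecidableEq A'] [Fintype B']

/-- The exponents `l` with `ρ ≤ 2 ^ l • (id_A ⊗ σ)` for some density operator `σ` on `B`; the
min-entropy of `ρ` is minus their infimum. -/
def minEntropyExponents (ρ : Matrix (A × B) (A × B) ℂ) : Set ℝ :=
  {l | ∃ σ, IsDensity σ ∧ ρ ≤ (((2 : ℝ) ^ l : ℝ) : ℂ) • ((1 : Matrix A A ℂ) ⊗ₖ σ)}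

lemma minEntropyExponents_nonempty {ρ : Matrix (A × B) (A × B) ℂ} (hρ : IsDensity ρ) :
    (minEntropyExponents ρ).Nonempty := by
  classical
  obtain ⟨a, -⟩ := hρ.nonempty
  have hcard : (0 : ℝ) < Fintype.card A := Nat.cast_pos.mpr (Fintype.card_pos_iff.mpr ⟨a⟩)
  have hswap := hρ.submatrix_equiv (Equiv.prodComm B A)
  refine ⟨Real.logb 2 (Fintype.card A), _, isCPTP_traceRight.isDensity_apply hswap, ?_⟩
  rw [Real.rpow_logb two_pos (by norm_num) hcard, ← submatrix_equiv_le_iff (Equiv.prodComm B A)]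
  convert le_card_smul_traceRight_kronecker_one hswap.1 using 1
  rw [Complex.ofReal_natCast]
  ext x y
  exact congrArg ((Fintype.card A : ℂ) • ·) (mul_comm (G := ℂ) _ _)

lemma bddBelow_minEntropyExponents {ρ : Matrix (A × B) (A × B) ℂ} (hρ : IsDensity ρ) :
    BddBelow (minEntropyExponents ρ) := by
  obtain ⟨a, -⟩ := hρ.nonempty
  have hcard : (0 : ℝ) < Fintype.card A := Nat.cast_pos.mpr (Fintype.card_pos_iff.mpr ⟨a⟩)
  refine ⟨Real.logb 2 (Fintype.card A : ℝ)⁻¹, ?_⟩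
  rintro l ⟨σ, hσ, hl⟩
  have htrace := (le_iff.mp hl).trace_nonneg
  rw [trace_sub, trace_smul, trace_kronecker, trace_one, hσ.2, hρ.2, mul_one, smul_eq_mul,
    sub_nonneg] at htrace
  rw [Real.logb_le_iff_le_rpow one_lt_two (inv_pos.mpr hcard), inv_le_iff_one_le_mul₀ hcard]
  exact_mod_cast htrace

lemma minEntropy_sub_le_minEntropy {ρ : Matrix (A × B) (A × B) ℂ}
    {ρ' : Matrix (A' × B') (A' × B') ℂ} (hρ : IsDensity ρ) (hρ' : IsDensity ρ') {t : ℝ}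
    (h : ∀ l ∈ minEntropyExponents ρ, l + t ∈ minEntropyExponents ρ') :
    minEntropy ρ - t ≤ minEntropy ρ' := by
  have hinf : sInf (minEntropyExponents ρ') - t ≤ sInf (minEntropyExponents ρ) :=
    le_csInf (minEntropyExponents_nonempty hρ) fun l hl =>
      sub_le_iff_le_add.mpr (csInf_le (bddBelow_minEntropyExponents hρ') (h l hl))
  change -sInf (minEntropyExponents ρ) - t ≤ -sInf (minEntropyExponents ρ')
  linarith

lemma minEntropy_le_minEntropy_idTensor [DecidableEq B] {ρ : Matrix (A × B) (A × B) ℂ}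
    {T : SuperOp B B'} (hρ : IsDensity ρ) (hT : IsCPTP T) :
    minEntropy ρ ≤ minEntropy (idTensor A T ρ) := by
  rw [← sub_zero (minEntropy ρ)]
  refine minEntropy_sub_le_minEntropy hρ (hT.idTensor.isDensity_apply hρ) ?_
  rintro l ⟨σ, hσ, hl⟩
  refine ⟨T σ, hT.isDensity_apply hσ, ?_⟩
  rw [add_zero, ← idTensor_kronecker, ← map_smul]
  exact hT.idTensor.monotone hl

lemma minEntropy_idTensor_traceRight_sub_le [Fintype X]
    {ρ : Matrix (A × B × X) (A × B × X) ℂ} (hρ : IsDensity ρ) :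
    minEntropy (idTensor A (traceRight B X) ρ) - 2 * Real.logb 2 (Fintype.card X) ≤
      minEntropy ρ := by
  classical
  obtain ⟨-, -, x⟩ := hρ.nonempty
  have : Nonempty X := ⟨x⟩
  refine minEntropy_sub_le_minEntropy (isCPTP_traceRight.idTensor.isDensity_apply hρ) hρ ?_
  rintro l ⟨σ, hσ, hl⟩
  refine ⟨_, hσ.kronecker (isDensity_maximallyMixed X), ?_⟩
  have hd : (2 : ℝ) ^ (l + 2 * Real.logb 2 (Fintype.card X)) =
      Fintype.card X * 2 ^ l * Fintype.card X := by
    rw [two_mul, Real.rpow_add two_pos, Real.rpow_add two_pos,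
      Real.rpow_logb two_pos (by norm_num) (by simp [Fintype.card_pos])]
    ring
  let e := Equiv.prodAssoc A B X
  have htrace : traceRight (A × B) X (ρ.submatrix e e) = idTensor A (traceRight B X) ρ := by
    ext x y
    simp [traceRight_apply, idTensor, e]
  have hassoc : ((1 : Matrix A A ℂ) ⊗ₖ σ) ⊗ₖ (1 : Matrix X X ℂ) =
      ((1 : Matrix A A ℂ) ⊗ₖ (σ ⊗ₖ (1 : Matrix X X ℂ))).submatrix e e := by
    ext x y
    exact mul_assoc _ _ _
  rw [← submatrix_equiv_le_iff e]
  calc ρ.submatrix e e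
      ≤ (Fintype.card X : ℂ) • (idTensor A (traceRight B X) ρ ⊗ₖ (1 : Matrix X X ℂ)) :=
        htrace ▸ le_card_smul_traceRight_kronecker_one (hρ.submatrix_equiv e).1
    _ ≤ (Fintype.card X : ℂ) •
          (((((2 : ℝ) ^ l : ℝ) : ℂ) • ((1 : Matrix A A ℂ) ⊗ₖ σ)) ⊗ₖ (1 : Matrix X X ℂ)) :=
        smul_le_smul_of_nonneg_left (kronecker_le_kronecker_right hl PosSemidef.one)
          (Nat.cast_nonneg _)
    _ = _ := by
        rw [smul_kronecker, hassoc, hd]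
        simp only [kronecker_smul, submatrix_smul, Pi.smul_apply, smul_smul]
        push_cast
        rw [mul_inv_cancel_right₀ (by simp)]

end MinEntropy

section Steps

open Matrix

variable {C A A' B B' X Y : Type}

lemma IsClassical.bobStep (T : SuperOp B B') {M : Matrix (C × A × B) (C × A × B) ℂ}
    (hM : IsClassical M) : IsClassical (bobStep T M) := fun x y hxy => by
  have hblock : (Matrix.of fun i j => M (x.1, x.2.1, i) (y.1, y.2.1, j)) = 0 := by
    ext i j
    exact hM _ _ hxy
  exact congrFun₂ ((congrArg T hblock).trans (map_zero T)) x.2.2 y.2.2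

lemma IsClassical.handOver {M : Matrix (C × A × (B × Y)) (C × A × (B × Y)) ℂ}
    (hM : IsClassical M) : IsClassical (handOver M) := fun _ _ hxy => hM _ _ hxy

lemma traceAlice_bobStep [Fintype A] (T : SuperOp B B') (M : Matrix (C × A × B) (C × A × B) ℂ) :
    traceAlice (bobStep T M) = idTensor C T (traceAlice M) := by
  ext x y
  have h := congrFun₂ (map_sum T (fun a => Matrix.of fun i j => M (x.1, a, i) (y.1, a, j))
    Finset.univ) x.2 y.2
  rw [Matrix.sum_apply] at h
  refine h.symm.trans (congrFun₂ (congrArg T ?_) x.2 y.2)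
  ext i j
  exact Matrix.sum_apply _ _ _ _

lemma traceAlice_handOver [Fintype A] [Fintype Y]
    (M : Matrix (C × A × (B × Y)) (C × A × (B × Y)) ℂ) :
    traceAlice (handOver M) = idTensor C (traceRight B Y) (traceAlice M) := by
  ext x y
  simp only [traceAlice, handOver, idTensor, LinearMap.coe_mk, AddHom.coe_mk, of_apply,
    submatrix_apply, traceRight_apply, Fintype.sum_prod_type]
  exact Finset.sum_comm

section BobSteps

variable [Fintype C] [Fintype A] [Fintype B]

lemma IsDensity.traceAlice {M : Matrix (C × A × B) (C × A × B) ℂ} (hM : IsDensity M) :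
    IsDensity (traceAlice M) := by
  classical
  let e : (C × B) × A ≃ C × A × B :=
    (Equiv.prodAssoc C B A).trans (Equiv.prodCongr (Equiv.refl C) (Equiv.prodComm B A))
  convert isCPTP_traceRight.isDensity_apply (hM.submatrix_equiv e) using 1
  ext x y
  exact (traceRight_apply (M.submatrix e e) x y).symm

lemma IsDensity.bobStep [DecidableEq B] [Fintype B'] {T : SuperOp B B'} (hT : IsCPTP T)
    {M : Matrix (C × A × B) (C × A × B) ℂ} (hM : IsDensity M) : IsDensity (bobStep T M) := by
  classical
  exact (hT.idTensor.isDensity_apply (hM.submatrix_equiv (Equiv.prodAssoc C A B))).submatrix_equiv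
    (Equiv.prodAssoc C A B').symm

lemma IsDensity.handOver [Fintype Y] {M : Matrix (C × A × (B × Y)) (C × A × (B × Y)) ℂ}
    (hM : IsDensity M) : IsDensity (handOver M) :=
  hM.submatrix_equiv
    { toFun x := (x.1, x.2.1.1, (x.2.2, x.2.1.2))
      invFun x := (x.1, (x.2.1, x.2.2.2), x.2.2.1) }

lemma minEntropy_traceAlice_le_handOver [DecidableEq C] [Fintype Y]
    {M : Matrix (C × A × (B × Y)) (C × A × (B × Y)) ℂ} (hM : IsDensity M) :
    minEntropy (traceAlice M) ≤ minEntropy (traceAlice (handOver M)) := by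
  classical
  rw [traceAlice_handOver]
  exact minEntropy_le_minEntropy_idTensor hM.traceAlice isCPTP_traceRight

end BobSteps

section AliceSteps

variable [Fintype C] [DecidableEq C] [Fintype A] [DecidableEq A] [Fintype A'] [Fintype X]

lemma IsClassical.aliceStep {T : SuperOp (C × A) (C × (A' × X))}
    (hT : IsClassicallyControlled T) {M : Matrix (C × A × B) (C × A × B) ℂ}
    (hM : IsClassical M) : IsClassical (aliceStep T M) := fun _ _ hxy =>
  hT.isClassical_apply (fun _ _ hij => hM _ _ hij) _ _ hxy

lemma idTensor_traceRight_traceAlice_aliceStep {T : SuperOp (C × A) (C × (A' × X))}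
    (hT : IsClassicallyControlled T) {M : Matrix (C × A × B) (C × A × B) ℂ}
    (hM : IsClassical M) :
    idTensor C (traceRight B X) (traceAlice (aliceStep T M)) = traceAlice M := by
  ext x y
  have hblock : IsClassical (Matrix.of fun i j : C × A => M (i.1, i.2, x.2) (j.1, j.2, y.2)) :=
    fun i j hij => hM _ _ hij
  have h := congrFun₂ (hT.traceRight_apply hblock) x.1 y.1
  simp only [traceRight_apply, Fintype.sum_prod_type] at h
  rw [Finset.sum_comm] at h
  exact (traceRight_apply _ _ _).trans h

variable [Fintype B]

lemma IsDensity.aliceStep {T : SuperOp (C × A) (C × (A' × X))} (hT : IsCPTP T)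
    {M : Matrix (C × A × B) (C × A × B) ℂ} (hM : IsDensity M) :
    IsDensity (aliceStep T M) := by
  classical
  let e₁ : B × (C × A) ≃ C × A × B := (Equiv.prodComm _ _).trans (Equiv.prodAssoc C A B)
  let e₂ : C × A' × (B × X) ≃ B × (C × (A' × X)) :=
    { toFun x := (x.2.2.1, (x.1, (x.2.1, x.2.2.2)))
      invFun x := (x.2.1, x.2.2.1, (x.1, x.2.2.2)) }
  exact (hT.idTensor.isDensity_apply (hM.submatrix_equiv e₁)).submatrix_equiv e₂

lemma minEntropy_traceAlice_sub_le_bobStep_aliceStep [DecidableEq B] [DecidableEq X] [Fintype B']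
    {T : SuperOp (C × A) (C × (A' × X))} {S : SuperOp (B × X) B'}
    (hT : IsClassicallyControlled T) (hS : IsCPTP S)
    {M : Matrix (C × A × B) (C × A × B) ℂ} (hM : IsDensity M) (hMC : IsClassical M) :
    minEntropy (traceAlice M) - 2 * Real.logb 2 (Fintype.card X) ≤
      minEntropy (traceAlice (bobStep S (aliceStep T M))) := by
  have hN : IsDensity (traceAlice (aliceStep T M)) := (hM.aliceStep hT.1).traceAlice
  calc minEntropy (traceAlice M) - 2 * Real.logb 2 (Fintype.card X)
      = minEntropy (idTensor C (traceRight B X) (traceAlice (aliceStep T M))) -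
          2 * Real.logb 2 (Fintype.card X) := by
        rw [idTensor_traceRight_traceAlice_aliceStep hT hMC]
    _ ≤ minEntropy (traceAlice (aliceStep T M)) := minEntropy_idTensor_traceRight_sub_le hN
    _ ≤ minEntropy (traceAlice (bobStep S (aliceStep T M))) := by
        rw [traceAlice_bobStep]
        exact minEntropy_le_minEntropy_idTensor hN hS

end AliceSteps

end Steps

section Initial

variable {C B : Type}

lemma eprVector_dotProduct_star_self : eprVector ⬝ᵥ star eprVector = 1 := by
  have hsqrt : ((Real.sqrt 2 : ℝ) : ℂ)⁻¹ * ((Real.sqrt 2 : ℝ) : ℂ)⁻¹ = 2⁻¹ := by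
    rw [← mul_inv, ← Complex.ofReal_mul, Real.mul_self_sqrt zero_le_two, Complex.ofReal_ofNat]
  simp [dotProduct, Fintype.sum_prod_type, eprVector, hsqrt]

lemma isDensity_eprPairs (m : ℕ) : IsDensity (eprPairs m) := by
  refine isDensity_vecMulVec_star ?_
  let e := Equiv.arrowProdEquivProdArrow (Fin m) (fun _ => Fin 2) (fun _ => Fin 2)
  calc (∑ x : Qubits m × Qubits m, (∏ k, eprVector (x.1 k, x.2 k)) *
        star (∏ k, eprVector (x.1 k, x.2 k)))
      = ∑ z : Fin m → Fin 2 × Fin 2, ∏ k, eprVector (z k) * star (eprVector (z k)) := by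
        simp only [star_prod, ← Finset.prod_mul_distrib]
        exact (e.sum_comp _).symm
    _ = (eprVector ⬝ᵥ star eprVector) ^ m :=
      (Fintype.sum_pow (fun x => eprVector x * star (eprVector x)) m).symm
    _ = 1 := by rw [eprVector_dotProduct_star_self, one_pow]

variable [Fintype C] [DecidableEq C] [Fintype B]

lemma IsCQState.initialState {ρ : Matrix (C × B) (C × B) ℂ} (m : ℕ) (hρ : IsCQState ρ) :
    IsCQState (initialState m ρ) := by
  obtain ⟨p, ρB, hp, hρB, rfl⟩ := hρ
  let e : Qubits m × (B × Qubits m) ≃ (Qubits m × Qubits m) × B :=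
    { toFun x := ((x.1, x.2.2), x.2.1)
      invFun x := (x.1.1, x.2, x.1.2) }
  refine ⟨p, fun a => (eprPairs m ⊗ₖ ρB a).submatrix e e, hp,
    fun a => ((isDensity_eprPairs m).kronecker (hρB a)).submatrix_equiv e, ?_⟩
  ext x y
  simp only [LeakageChain.initialState, cqOperator, Matrix.sum_apply, Finset.mul_sum,
    Matrix.submatrix_apply, Matrix.kronecker_apply]
  exact Finset.sum_congr rfl fun a _ =>
    (mul_left_comm _ _ _).trans (congrArg ((p a : ℂ) * ·) (mul_left_comm _ _ _))

end Initial

namespace Protocol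

variable {C A₀ B₀ : Type} [Fintype C] [DecidableEq C] [Fintype A₀] [DecidableEq A₀] [Fintype B₀]
  [DecidableEq B₀] {n : ℕ} {M : Matrix (C × A₀ × B₀) (C × A₀ × B₀) ℂ}

lemma isDensity_stateAfter (P : Protocol C A₀ B₀ n) (hM : IsDensity M) :
    ∀ k ≤ n, IsDensity (P.stateAfter M k)
  | 0, _ => hM
  | k + 1, hk => (((P.isDensity_stateAfter hM k (by lia)).aliceStep
      (P.controlled k (by lia)).1).bobStep (P.cptp k hk)).handOver

lemma isClassical_stateAfter (P : Protocol C A₀ B₀ n) (hM : IsClassical M) :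
    ∀ k ≤ n, IsClassical (P.stateAfter M k)
  | 0, _ => hM
  | k + 1, hk => (((P.isClassical_stateAfter hM k (by lia)).aliceStep
      (P.controlled k (by lia))).bobStep (P.Ψ k)).handOver

lemma minEntropy_traceAlice_sub_le_stateAfter (P : Protocol C A₀ B₀ n) (hM : IsCQState M) {k : ℕ}
    (hk : k ≤ n) :
    minEntropy (traceAlice M) - 2 * ∑ i ∈ Finset.range k, Real.logb 2 (P.dX (i + 1)) ≤
      minEntropy (traceAlice (P.stateAfter M k)) := by
  induction k with
  | zero =>
    rw [Finset.sum_range_zero, mul_zero, sub_zero]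
    exact le_rfl
  | succ k ih =>
    have hD := P.isDensity_stateAfter hM.isDensity k (by lia)
    have hT := P.controlled k (by lia)
    have hround := minEntropy_traceAlice_sub_le_bobStep_aliceStep hT (P.cptp k hk) hD
      (P.isClassical_stateAfter hM.isClassical k (by lia))
    have hhand := minEntropy_traceAlice_le_handOver
      ((hD.aliceStep hT.1).bobStep (P.cptp k hk))
    rw [Fintype.card_fin] at hround
    rw [Finset.sum_range_succ]
    exact le_trans (by linarith [ih (by lia)]) hhand

end Protocol

end LeakageChain

theorem mainTheorem2_general
    {C A₀ B₀ : Type} [Fintype C] [DecidableEq C] [Fintype A₀] [DecidableEq A₀] [Fintype B₀]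
    [DecidableEq B₀] {n : ℕ} {M : Matrix (C × A₀ × B₀) (C × A₀ × B₀) ℂ}
    (hM : LeakageChain.IsCQState M) (P : LeakageChain.Protocol C A₀ B₀ n) :
    LeakageChain.minEntropy (LeakageChain.traceAlice (P.run M)) ≥
      LeakageChain.minEntropy (LeakageChain.traceAlice M) - 2 * P.commA := by
  have hrounds := P.minEntropy_traceAlice_sub_le_stateAfter hM le_rfl
  have hlast := LeakageChain.minEntropy_traceAlice_sub_le_bobStep_aliceStep (P.controlled n le_rfl)
    P.cptp_last (P.isDensity_stateAfter hM.isDensity n le_rfl)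
    (P.isClassical_stateAfter hM.isClassical n le_rfl)
  rw [Fintype.card_fin] at hlast
  rw [LeakageChain.Protocol.commA, Finset.sum_range_succ]
  exact le_trans (by linarith) hlast

theorem mainTheorem2
    {C B : Type} [Fintype C] [DecidableEq C] [Fintype B] [DecidableEq B]
    (m n : ℕ) (mA mB : ℝ)
    (ρ : Matrix (C × B) (C × B) ℂ) (hρ : LeakageChain.IsCQState ρ)
    (P : LeakageChain.Protocol C (LeakageChain.Qubits m) (B × LeakageChain.Qubits m) n)
    (hA : P.commA = mA) (hB : P.commB = mB) (hm : mA ≤ m) :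
    LeakageChain.minEntropy
        (LeakageChain.traceAlice (P.run (LeakageChain.initialState m ρ))) ≥
      LeakageChain.minEntropy
        (LeakageChain.traceAlice (LeakageChain.initialState m ρ)) - 2 * mA :=
  hA ▸ mainTheorem2_general (hρ.initialState m) P
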